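/- Let $K$ be an algebraically closed field of characteristic zero and let $H$ be a semisimple Hopf algebra of finite dimension $n$ over $K$, with multiplication $m$, comultiplication $\Delta$, counit $\varepsilon$ and antipode $S$. Let $\Lambda$ be the integral of $H$ with $\varepsilon(\Lambda)=n$, and put $\nu=\sum_{(\Lambda)}\Lambda_1\otimes S(\Lambda_2)\in H\otimes_K H$. For a subring $R\subseteq K$, a weak $R$-form of $H$ is a free $R$-submodule $H_R\subseteq H$ with an $R$-basis $x_1,\dots,x_n$ that is a $K$-basis of $H$ and for which all coefficients $m_{i,j}^k$ and $\nu^{i,j}$ in $x_ix_j=\sum_k m_{i,j}^k x_k$ and $\nu=\sum_{i,j}\nu^{i,j}\,x_i\otimes x_j$ belong to $R$. Let $L\subseteq K$ be an algebraic number field (a subfield of finite degree over $\mathbb{Q}$) and let $\mathbb{A}\subseteq K$ be the ring of algebraic integers. If $H$ admits a weak $(\mathbb{A}\cap L)$-form, then $H$ is of Frobenius type: the degree (the dimension over $K$) of every irreducible representation of $H$ divides $n$. -/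

import Mathlib

open scoped TensorProduct

universe u v w

namespace HopfWeakForm

section Integral

variable (K : Type u) (H : Type v) [Field K] [Ring H] [HopfAlgebra K H]

/-- `Λ` is a left integral of `H`: `h * Λ = ε(h) Λ` for all `h`. -/
def IsLeftIntegral (Λ : H) : Prop :=
  ∀ h : H, h * Λ = (Coalgebra.counit (R := K) h) • Λ

/-- A semisimple Hopf algebra has a left integral `Λ` with `ε(Λ) = dim H`. -/
theorem exists_integral [IsSemisimpleRing H] :
    ∃ Λ : H, IsLeftIntegral K H Λ ∧
      Coalgebra.counit (R := K) Λ = (Module.finrank K H : K) := by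
  let ε : H →ₐ[K] K := Bialgebra.counitAlgHom K H
  obtain ⟨J, hJ⟩ := exists_isCompl (RingHom.ker ε : Submodule H H)
  obtain ⟨i, hi, j, hj, hij⟩ :=
    Submodule.mem_sup.mp (hJ.sup_eq_top ▸ Submodule.mem_top : (1 : H) ∈ RingHom.ker ε ⊔ J)
  have hi0 : ε i = 0 := hi
  have hj1 : ε j = 1 := by
    have := congrArg ε hij
    simpa [hi0] using this
  have key : ∀ h : H, h * j = ε h • j := by
    intro h
    have h1 : (h - algebraMap K H (ε h)) * j ∈ RingHom.ker ε := by
      rw [RingHom.mem_ker]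
      simp
    have h2 : (h - algebraMap K H (ε h)) * j ∈ J := J.smul_mem _ hj
    have h3 := (Submodule.disjoint_def.mp hJ.disjoint) _ h1 h2
    rw [sub_mul, sub_eq_zero] at h3
    rw [h3, Algebra.smul_def]
  refine ⟨(Module.finrank K H : K) • j, fun h => ?_, ?_⟩
  · rw [mul_smul_comm, key h, smul_comm]
    rfl
  · have hc : Coalgebra.counit (R := K) j = 1 := hj1
    rw [map_smul, hc, smul_eq_mul, mul_one]

/-- The integral `Λ` of a semisimple Hopf algebra, normalized by `ε(Λ) = dim H`. -/
noncomputable def integral [IsSemisimpleRing H] : H :=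
  (exists_integral K H).choose

/-- The defining properties of `integral K H`. -/
theorem integral_spec [IsSemisimpleRing H] :
    IsLeftIntegral K H (integral K H) ∧
      Coalgebra.counit (R := K) (integral K H) = (Module.finrank K H : K) :=
  (exists_integral K H).choose_spec

/-- The element `ν = ∑ Λ₁ ⊗ S(Λ₂)` of `H ⊗ H`. -/
noncomputable def nu [IsSemisimpleRing H] : H ⊗[K] H :=
  (HopfAlgebra.antipode K (A := H)).lTensor H (Coalgebra.comul (R := K) (integral K H))

end Integral

section Form

variable (K : Type u) (H : Type v) [Field K] [Ring H] [HopfAlgebra K H] [IsSemisimpleRing H]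

/-- `HR` is a weak `R`-form of `H`: it is the `R`-span of a `K`-basis `x` of `H` (hence free over
`R` with `R`-basis `x`) such that the structure constants of the multiplication and the
coefficients of `ν` with respect to `x` belong to `R`. -/
def IsWeakForm (R : Subring K) (HR : Submodule R H) : Prop :=
  ∃ x : Module.Basis (Fin (Module.finrank K H)) K H,
    HR = Submodule.span R (Set.range x) ∧
    (∀ i j k, x.repr (x i * x j) k ∈ R) ∧
    (∀ i j, (x.tensorProduct x).repr (nu K H) (i, j) ∈ R)

/-- `H` admits a weak `R`-form. -/
def HasWeakForm (R : Subring K) : Prop :=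
  ∃ HR : Submodule R H, IsWeakForm K H R HR

end Form

/-- `H` is of Frobenius type: the degree of every irreducible representation of `H`
divides the dimension of `H`. -/
def IsOfFrobeniusType (K : Type u) (H : Type v) [Field K] [Ring H] [Algebra K H] : Prop :=
  ∀ (M : Type w) [AddCommGroup M] [Module K M] [Module H M] [IsScalarTower K H M]
    [IsSimpleModule H M], Module.finrank K M ∣ Module.finrank K H

end HopfWeakForm

namespace HopfWeakForm

open Coalgebra HopfAlgebra TensorProduct WithConv

/-! ### Convolution identities for the comultiplication and antipode; contractions by functionals.
-/

section HopfBasics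

variable {K : Type u} {H : Type v} [Field K] [Ring H] [HopfAlgebra K H]

local notation "S" => antipode K (A := H)
local notation "i₁" => AlgHom.toLinearMap (Algebra.TensorProduct.includeLeft : H →ₐ[K] H ⊗[K] H)
local notation "i₂" => AlgHom.toLinearMap (Algebra.TensorProduct.includeRight : H →ₐ[K] H ⊗[K] H)

/-! Let `π` be an irreducible representation on `V`, of dimension `d`. The integral property makes
`∑ π(Λ₁) X π(S(Λ₂))` a scalar matrix, equal to `tr(tX) • 1` for a matrix `t` of trace `n` with `t
π(h) = π(S²(h)) t` (`IsLeftIntegral.exists_twist`). Since `S² = 1` by Larson–Radford, `t = c • 1`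
with `c d = n`, and `ν` acts on `V ⊗ V` as `c` times the flip, with square `c²`
(`exists_tensorAction_nu_mul_self`). For a weak form over `R`, the images of the `xᵢ ⊗ xⱼ` in `End(V
⊗ V)` span a nonzero finitely generated `R`-module stable under `ν`, hence under `c²`; so `c²` is
integral over `R` (`isIntegral_of_isWeakForm`). As `R` consists of algebraic integers, `c = n/d` is
a rational algebraic integer.

Most of the work is `S² = 1` (`antipodeSq_eq_self`). A functional `l` with `l(Λ₁) Λ₂ = 1` is a
Frobenius form with Nakayama automorphism `S²`. It gives `tr(S²) = ε(Λ) l(1)`, and `S⁴` is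
conjugation by a group-like element `b`, so `S²` has finite order. Over the matrix blocks, `tr(S²)`
is the sum of the `tr(tᵢ) tr(tᵢ⁻¹)` with `tᵢ` of finite order up to scalars; each summand becomes
positive in `ℂ`, so `tr(S²) ≠ 0`. Now `l(1) ≠ 0` forces `b = 1`, so `S⁴ = 1`. Finally the regular
character shows that `l(1)` is an integer. So the involution `S²` has as trace a nonzero multiple of
the dimension, and it fixes `1`, which leaves only the identity. -/

theorem toConv_comul :
    toConv (comul : H →ₗ[K] H ⊗[K] H) = toConv i₁ * toConv i₂ := by
  ext h
  rw [(ℛ K h).convMul_apply]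
  simp [(ℛ K h).eq]

theorem algHom_antipode_convMul {A : Type*} [Ring A] [Algebra K A] (f : H →ₐ[K] A) :
    toConv (f.toLinearMap ∘ₗ S) * toConv f.toLinearMap = 1 := by
  ext h
  rw [(ℛ K h).convMul_apply]
  simp [← map_mul, ← map_sum, sum_antipode_mul_eq_algebraMap_counit (ℛ K h)]

theorem algHom_convMul_antipode {A : Type*} [Ring A] [Algebra K A] (f : H →ₐ[K] A) :
    toConv f.toLinearMap * toConv (f.toLinearMap ∘ₗ S) = 1 := by
  ext h
  rw [(ℛ K h).convMul_apply]
  simp [← map_mul, ← map_sum, sum_mul_antipode_eq_algebraMap_counit (ℛ K h)]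

/-- In the convolution algebra `Δ = i₁ * i₂`, so `(i₂ ∘ S) * (i₁ ∘ S)` is a left inverse of `Δ`,
while `Δ ∘ S` is a right inverse; the two coincide. -/
theorem comul_antipode (h : H) :
    comul (R := K) (S h) = TensorProduct.map S S (TensorProduct.comm K H H (comul h)) := by
  have h1 : (toConv (i₂ ∘ₗ S) * toConv (i₁ ∘ₗ S)) * toConv (comul : H →ₗ[K] H ⊗[K] H) = 1 := by
    rw [toConv_comul, mul_assoc, ← mul_assoc (toConv (i₁ ∘ₗ S)),
      algHom_antipode_convMul, one_mul, algHom_antipode_convMul]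
  have h2 := left_inv_eq_right_inv h1 LinearMap.comul_right_inv
  have h3 := congrArg (fun f => f.ofConv h) h2
  simp only at h3
  rw [(ℛ K h).convMul_apply] at h3
  conv_rhs => rw [← (ℛ K h).eq]
  simpa using h3.symm

theorem sum_antipode_tmul_mul_comul (h : H) :
    ∑ i ∈ (ℛ K h).index, (S ((ℛ K h).left i) ⊗ₜ[K] (1 : H)) * comul ((ℛ K h).right i) =
      (1 : H) ⊗ₜ[K] h := by
  have h1 : toConv (i₁ ∘ₗ S) * toConv (comul : H →ₗ[K] H ⊗[K] H) = toConv i₂ := by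
    rw [toConv_comul, ← mul_assoc, algHom_antipode_convMul, one_mul]
  have h3 := congrArg (fun f => f.ofConv h) h1
  simp only at h3
  rw [(ℛ K h).convMul_apply] at h3
  simpa using h3

theorem sum_comul_mul_tmul_antipode (h : H) :
    ∑ i ∈ (ℛ K h).index, comul ((ℛ K h).left i) * ((1 : H) ⊗ₜ[K] S ((ℛ K h).right i)) =
      h ⊗ₜ[K] (1 : H) := by
  have h1 : toConv (comul : H →ₗ[K] H ⊗[K] H) * toConv (i₂ ∘ₗ S) = toConv i₁ := by
    rw [toConv_comul, mul_assoc, algHom_convMul_antipode, mul_one]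
  have h3 := congrArg (fun f => f.ofConv h) h1
  simp only at h3
  rw [(ℛ K h).convMul_apply] at h3
  simpa using h3

/-- The square of the antipode as an algebra homomorphism. -/
noncomputable def antipodeSq : H →ₐ[K] H :=
  AlgHom.ofLinearMap (S ∘ₗ S) (by simp) (by simp [antipode_mul_antidistrib])

theorem antipodeSq_apply (h : H) : antipodeSq (K := K) h = S (S h) := rfl

theorem comul_antipodeSq (h : H) :
    comul (R := K) (antipodeSq (K := K) h) =
      TensorProduct.map (antipodeSq (K := K)).toLinearMap (antipodeSq (K := K)).toLinearMap
        (comul h) := by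
  rw [antipodeSq_apply, comul_antipode, comul_antipode]
  generalize comul (R := K) h = z
  induction z with
  | zero => simp
  | add x y hx hy => simp only [map_add, hx, hy]
  | tmul x y => simp [antipodeSq_apply]

/-- Left contraction `f(z₁) z₂`. -/
noncomputable def contractLeft (f : H →ₗ[K] K) : H ⊗[K] H →ₗ[K] H :=
  (TensorProduct.lid K H).toLinearMap ∘ₗ f.rTensor H

/-- Right contraction `z₁ f(z₂)`. -/
noncomputable def contractRight (f : H →ₗ[K] K) : H ⊗[K] H →ₗ[K] H :=
  (TensorProduct.rid K H).toLinearMap ∘ₗ f.lTensor H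

@[simp] theorem contractLeft_tmul (f : H →ₗ[K] K) (x y : H) :
    contractLeft f (x ⊗ₜ y) = f x • y := by simp [contractLeft]

@[simp] theorem contractRight_tmul (f : H →ₗ[K] K) (x y : H) :
    contractRight f (x ⊗ₜ y) = f y • x := by simp [contractRight]

/-- `h ↦ f(h₁) h₂`. -/
noncomputable def hitLeft (f : H →ₗ[K] K) : H →ₗ[K] H := contractLeft f ∘ₗ comul

/-- `h ↦ h₁ f(h₂)`. -/
noncomputable def hitRight (f : H →ₗ[K] K) : H →ₗ[K] H := contractRight f ∘ₗ comul

theorem hitLeft_apply (f : H →ₗ[K] K) (h : H) : hitLeft f h = contractLeft f (comul h) := rfl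

theorem hitRight_apply (f : H →ₗ[K] K) (h : H) : hitRight f h = contractRight f (comul h) := rfl

/-- Coassociativity with `f` applied to the last of the three tensor factors. -/
theorem lTensor_hitRight (f : H →ₗ[K] K) (h : H) :
    (hitRight f).lTensor H (comul h) = comul (hitRight f h) := by
  have h1 := congrArg ((TensorProduct.rid K (H ⊗[K] H)).toLinearMap ∘ₗ f.lTensor (H ⊗[K] H))
    (coassoc_symm_apply (R := K) h)
  have e1 : (hitRight f).lTensor H (comul h) =
      ((TensorProduct.rid K (H ⊗[K] H)).toLinearMap ∘ₗ f.lTensor (H ⊗[K] H))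
        ((TensorProduct.assoc K H H H).symm ((comul (R := K)).lTensor H (comul h))) := by
    generalize comul (R := K) h = z
    induction z with
    | zero => simp
    | add x y hx hy => simp only [map_add, hx, hy]
    | tmul x y =>
      simp only [LinearMap.lTensor_tmul, hitRight_apply]
      generalize comul (R := K) y = z
      induction z with
      | zero => simp
      | add x y hx hy => simp only [map_add, tmul_add, hx, hy]
      | tmul a b => simp
  rw [e1, h1, hitRight_apply]
  generalize comul (R := K) h = z
  induction z with
  | zero => simp
  | add x y hx hy => simp only [map_add, hx, hy]
  | tmul x y => simp

theorem rTensor_hitLeft (f : H →ₗ[K] K) (h : H) :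
    (hitLeft f).rTensor H (comul h) = comul (hitLeft f h) := by
  have h1 := congrArg ((TensorProduct.lid K (H ⊗[K] H)).toLinearMap ∘ₗ f.rTensor (H ⊗[K] H))
    (coassoc_apply (R := K) h)
  have e1 : (hitLeft f).rTensor H (comul h) =
      ((TensorProduct.lid K (H ⊗[K] H)).toLinearMap ∘ₗ f.rTensor (H ⊗[K] H))
        ((TensorProduct.assoc K H H H) ((comul (R := K)).rTensor H (comul h))) := by
    generalize comul (R := K) h = z
    induction z with
    | zero => simp
    | add x y hx hy => simp only [map_add, hx, hy]
    | tmul x y =>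
      simp only [LinearMap.rTensor_tmul, hitLeft_apply]
      generalize comul (R := K) x = z
      induction z with
      | zero => simp
      | add x y hx hy => simp only [map_add, add_tmul, hx, hy]
      | tmul a b => simp [smul_tmul']
  rw [e1, h1, hitLeft_apply]
  generalize comul (R := K) h = z
  induction z with
  | zero => simp
  | add x y hx hy => simp only [map_add, hx, hy]
  | tmul x y => simp

theorem hitLeft_hitRight (f g : H →ₗ[K] K) (h : H) :
    hitLeft f (hitRight g h) = hitRight g (hitLeft f h) := by
  rw [hitLeft_apply, ← lTensor_hitRight, hitLeft_apply]
  induction comul (R := K) h with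
  | zero => simp
  | add x y hx hy => simp only [map_add, hx, hy]
  | tmul x y => simp

theorem apply_hitRight (f g : H →ₗ[K] K) (h : H) : f (hitRight g h) = g (hitLeft f h) := by
  rw [hitLeft_apply, hitRight_apply]
  induction comul (R := K) h with
  | zero => simp
  | add x y hx hy => simp only [map_add, hx, hy]
  | tmul x y => simp [mul_comm]

@[simp] theorem hitLeft_counit (h : H) : hitLeft (counit (R := K)) h = h := by
  simp [hitLeft, contractLeft]

@[simp] theorem hitRight_counit (h : H) : hitRight (counit (R := K)) h = h := by
  simp [hitRight, contractRight]

theorem hitLeft_antipode (f : H →ₗ[K] K) (h : H) :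
    hitLeft f (S h) = S (hitRight (f ∘ₗ S) h) := by
  rw [hitLeft_apply, hitRight_apply, comul_antipode]
  induction comul (R := K) h with
  | zero => simp
  | add x y hx hy => simp only [map_add, hx, hy]
  | tmul x y => simp

theorem hitLeft_antipodeSq (f : H →ₗ[K] K) (h : H) :
    hitLeft f (antipodeSq (K := K) h) =
      antipodeSq (K := K) (hitLeft (f ∘ₗ (antipodeSq (K := K)).toLinearMap) h) := by
  rw [hitLeft_apply, hitLeft_apply, comul_antipodeSq]
  induction comul (R := K) h with
  | zero => simp
  | add x y hx hy => simp only [map_add, hx, hy]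
  | tmul x y => simp

theorem sum_basis_tmul_contractLeft {ι : Type*} [Fintype ι] (e : Module.Basis ι K H)
    (z : H ⊗[K] H) : z = ∑ i, e i ⊗ₜ contractLeft (e.coord i) z := by
  induction z with
  | zero => simp
  | add x y hx hy => simp only [map_add, tmul_add, Finset.sum_add_distrib, ← hx, ← hy]
  | tmul x y =>
    conv_lhs => rw [← e.sum_repr x, sum_tmul]
    simp [smul_tmul']

theorem sum_contractRight_tmul_basis {ι : Type*} [Fintype ι] (e : Module.Basis ι K H)
    (z : H ⊗[K] H) : z = ∑ i, contractRight (e.coord i) z ⊗ₜ e i := by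
  induction z with
  | zero => simp
  | add x y hx hy => simp only [map_add, add_tmul, Finset.sum_add_distrib, ← hx, ← hy]
  | tmul x y =>
    conv_lhs => rw [← e.sum_repr y, tmul_sum]
    simp [smul_tmul']

end HopfBasics

/-! ### Exchange rules for the integral, nondegeneracy, and the integral of the dual. -/

section Integrals

variable {K : Type u} {H : Type v} [Field K] [Ring H] [HopfAlgebra K H] {Λ : H}

local notation "S" => antipode K (A := H)
local notation "ε" => counit (R := K) (A := H)

/-- Write `1 ⊗ h = (S(h₁) ⊗ 1) Δ(h₂)`; then `Δ(h₂) Δ(Λ) = Δ(h₂ Λ)` collapses to `ε(h₂) Δ(Λ)`. -/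
theorem IsLeftIntegral.tmul_mul_comul (hΛ : IsLeftIntegral K H Λ) (h : H) :
    ((1 : H) ⊗ₜ[K] h) * comul Λ = (S h ⊗ₜ[K] (1 : H)) * comul Λ := by
  rw [← sum_antipode_tmul_mul_comul, Finset.sum_mul]
  have key : S h = ∑ i ∈ (ℛ K h).index, ε ((ℛ K h).right i) • S ((ℛ K h).left i) := by
    have h1 := congrArg (fun z => S (contractRight ε z)) (ℛ K h).eq
    simp only [map_sum, contractRight_tmul, map_smul] at h1
    rw [h1, ← hitRight_apply, hitRight_counit]
  rw [key, sum_tmul, Finset.sum_mul]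
  refine Finset.sum_congr rfl fun i _ => ?_
  rw [mul_assoc, ← Bialgebra.comul_mul, hΛ, map_smul, mul_smul_comm, ← smul_tmul', smul_mul_assoc]

theorem comul_mul_tmul (hΛ : ∀ h : H, Λ * h = ε h • Λ) (h : H) :
    comul Λ * (h ⊗ₜ[K] (1 : H)) = comul Λ * ((1 : H) ⊗ₜ[K] S h) := by
  rw [← sum_comul_mul_tmul_antipode, Finset.mul_sum]
  have key : S h = ∑ i ∈ (ℛ K h).index, ε ((ℛ K h).left i) • S ((ℛ K h).right i) := by
    have h1 := congrArg (fun z => S (contractLeft ε z)) (ℛ K h).eq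
    simp only [map_sum, contractLeft_tmul, map_smul] at h1
    rw [h1, ← hitLeft_apply, hitLeft_counit]
  rw [key, tmul_sum, Finset.mul_sum]
  refine Finset.sum_congr rfl fun i _ => ?_
  rw [← mul_assoc, ← Bialgebra.comul_mul, hΛ, map_smul, smul_mul_assoc, tmul_smul, mul_smul_comm]

theorem contractLeft_tmul_one_mul (f : H →ₗ[K] K) (a : H) (z : H ⊗[K] H) :
    contractLeft f ((a ⊗ₜ 1) * z) = contractLeft (f ∘ₗ LinearMap.mulLeft K a) z := by
  induction z with
  | zero => simp
  | add x y hx hy => simp only [map_add, mul_add, hx, hy]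
  | tmul x y => simp

theorem contractLeft_mul_tmul_one (f : H →ₗ[K] K) (a : H) (z : H ⊗[K] H) :
    contractLeft f (z * (a ⊗ₜ 1)) = contractLeft (f ∘ₗ LinearMap.mulRight K a) z := by
  induction z with
  | zero => simp
  | add x y hx hy => simp only [map_add, add_mul, hx, hy]
  | tmul x y => simp

theorem contractLeft_one_tmul_mul (f : H →ₗ[K] K) (a : H) (z : H ⊗[K] H) :
    contractLeft f ((1 ⊗ₜ a) * z) = a * contractLeft f z := by
  induction z with
  | zero => simp
  | add x y hx hy => simp only [map_add, mul_add, hx, hy]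
  | tmul x y => simp

theorem contractLeft_mul_one_tmul (f : H →ₗ[K] K) (a : H) (z : H ⊗[K] H) :
    contractLeft f (z * (1 ⊗ₜ a)) = contractLeft f z * a := by
  induction z with
  | zero => simp
  | add x y hx hy => simp only [map_add, add_mul, hx, hy]
  | tmul x y => simp

theorem contractRight_mul_tmul_one (f : H →ₗ[K] K) (a : H) (z : H ⊗[K] H) :
    contractRight f (z * (a ⊗ₜ 1)) = contractRight f z * a := by
  induction z with
  | zero => simp
  | add x y hx hy => simp only [map_add, add_mul, hx, hy]
  | tmul x y => simp

theorem contractRight_mul_one_tmul (f : H →ₗ[K] K) (a : H) (z : H ⊗[K] H) :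
    contractRight f (z * (1 ⊗ₜ a)) = contractRight (f ∘ₗ LinearMap.mulRight K a) z := by
  induction z with
  | zero => simp
  | add x y hx hy => simp only [map_add, add_mul, hx, hy]
  | tmul x y => simp

theorem contractLeft_lTensor (f : H →ₗ[K] K) (g : H →ₗ[K] H) (z : H ⊗[K] H) :
    contractLeft f (g.lTensor H z) = g (contractLeft f z) := by
  induction z with
  | zero => simp
  | add x y hx hy => simp only [map_add, hx, hy]
  | tmul x y => simp

variable [Module.Finite K H]

/-- By the exchange rule the elements `f(Λ₁) Λ₂` form a left ideal. It contains `S(Λ₁) Λ₂ = ε(Λ) •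
1`, a nonzero multiple of `1`. -/
theorem IsLeftIntegral.exists_hitLeft_eq (hΛ : IsLeftIntegral K H Λ) (hε : ε Λ ≠ 0) (h : H) :
    ∃ f : H →ₗ[K] K, hitLeft f Λ = h := by
  have mulJ : ∀ (a : H) (f : H →ₗ[K] K), ∃ g : H →ₗ[K] K, hitLeft g Λ = a * hitLeft f Λ := by
    intro a f
    refine ⟨f ∘ₗ LinearMap.mulLeft K (S a), ?_⟩
    rw [hitLeft_apply, hitLeft_apply, ← contractLeft_one_tmul_mul, hΛ.tmul_mul_comul,
      contractLeft_tmul_one_mul]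
  let e := Module.finBasis K H
  choose g hg using fun i => mulJ (S (e i)) (e.coord i)
  have h1 : hitLeft (∑ i, g i) Λ = ε Λ • (1 : H) := by
    have h2 : hitLeft (∑ i, g i) Λ = ∑ i, hitLeft (g i) Λ := by
      simp only [hitLeft_apply]
      induction comul (R := K) Λ with
      | zero => simp
      | add x y hx hy => simp only [map_add, Finset.sum_add_distrib, hx, hy]
      | tmul x y => simp [Finset.sum_smul]
    have h3 := mul_antipode_rTensor_comul_apply (R := K) Λ
    rw [sum_basis_tmul_contractLeft e (comul Λ)] at h3
    rw [h2, Finset.sum_congr rfl fun i _ => hg i, ← Algebra.algebraMap_eq_smul_one, ← h3]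
    simp [hitLeft_apply]
  obtain ⟨f, hf⟩ := mulJ ((ε Λ)⁻¹ • h) (∑ i, g i)
  refine ⟨f, ?_⟩
  rw [hf, h1]
  simp [smul_smul, hε]

/-- With `f(Λ₁) Λ₂ = 1`, the exchange rule gives `h = f(S(h) Λ₁) Λ₂`, which recovers `h` from
`S(h)`. -/
theorem IsLeftIntegral.antipode_injective (hΛ : IsLeftIntegral K H Λ) (hε : ε Λ ≠ 0) :
    Function.Injective S := by
  rw [injective_iff_map_eq_zero]
  intro h hh
  obtain ⟨f, hf⟩ := hΛ.exists_hitLeft_eq hε 1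
  rw [← mul_one h, ← hf, hitLeft_apply, ← contractLeft_one_tmul_mul, hΛ.tmul_mul_comul, hh]
  simp

theorem IsLeftIntegral.antipode_surjective (hΛ : IsLeftIntegral K H Λ) (hε : ε Λ ≠ 0) :
    Function.Surjective S :=
  LinearMap.surjective_of_injective (hΛ.antipode_injective hε)

theorem IsLeftIntegral.antipode_mul (hΛ : IsLeftIntegral K H Λ) (hε : ε Λ ≠ 0) (h : H) :
    S Λ * h = ε h • S Λ := by
  obtain ⟨k, rfl⟩ := hΛ.antipode_surjective hε h
  rw [← antipode_mul_antidistrib, hΛ, map_smul, counit_antipode]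

/-- `S(Λ)` is a right integral and `Λ` a left one, so `S(Λ) Λ` equals both `ε(Λ) S(Λ)` and `ε(Λ) Λ`.
Hence `Λ` is two-sided. -/
theorem IsLeftIntegral.antipode_eq (hΛ : IsLeftIntegral K H Λ) (hε : ε Λ ≠ 0) : S Λ = Λ := by
  have h1 := hΛ.antipode_mul hε Λ
  rw [hΛ, counit_antipode] at h1
  exact (smul_right_injective H hε h1).symm

theorem IsLeftIntegral.mul_right (hΛ : IsLeftIntegral K H Λ) (hε : ε Λ ≠ 0) (h : H) :
    Λ * h = ε h • Λ := by
  simpa [hΛ.antipode_eq hε] using hΛ.antipode_mul hε h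

theorem IsLeftIntegral.exists_hitRight_eq (hΛ : IsLeftIntegral K H Λ) (hε : ε Λ ≠ 0) (h : H) :
    ∃ f : H →ₗ[K] K, hitRight f Λ = h := by
  have mulJ : ∀ (a : H) (f : H →ₗ[K] K), ∃ g : H →ₗ[K] K, hitRight g Λ = hitRight f Λ * a := by
    intro a f
    refine ⟨f ∘ₗ LinearMap.mulRight K (S a), ?_⟩
    rw [hitRight_apply, hitRight_apply, ← contractRight_mul_tmul_one,
      comul_mul_tmul (hΛ.mul_right hε), contractRight_mul_one_tmul]
  let e := Module.finBasis K H
  choose g hg using fun i => mulJ (S (e i)) (e.coord i)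
  have h1 : hitRight (∑ i, g i) Λ = ε Λ • (1 : H) := by
    have h2 : hitRight (∑ i, g i) Λ = ∑ i, hitRight (g i) Λ := by
      simp only [hitRight_apply]
      induction comul (R := K) Λ with
      | zero => simp
      | add x y hx hy => simp only [map_add, Finset.sum_add_distrib, hx, hy]
      | tmul x y => simp [Finset.sum_smul]
    have h3 := mul_antipode_lTensor_comul_apply (R := K) Λ
    rw [sum_contractRight_tmul_basis e (comul Λ)] at h3
    rw [h2, Finset.sum_congr rfl fun i _ => hg i, ← Algebra.algebraMap_eq_smul_one, ← h3]
    simp [hitRight_apply]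
  obtain ⟨f, hf⟩ := mulJ ((ε Λ)⁻¹ • h) (∑ i, g i)
  refine ⟨f, ?_⟩
  rw [hf, h1]
  simp [smul_smul, hε]

theorem IsLeftIntegral.eq_of_hitLeft_eq (hΛ : IsLeftIntegral K H Λ) (hε : ε Λ ≠ 0)
    {f g : H →ₗ[K] K} (hfg : hitLeft f Λ = hitLeft g Λ) : f = g := by
  ext h
  obtain ⟨p, rfl⟩ := hΛ.exists_hitRight_eq hε h
  rw [apply_hitRight, apply_hitRight, hfg]

/-- A functional `l` with `l(Λ₁) Λ₂ = 1` is an integral of the dual. -/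
structure IsDualIntegral (Λ : H) (l : H →ₗ[K] K) : Prop where
  isLeftIntegral : IsLeftIntegral K H Λ
  counit_ne_zero : ε Λ ≠ 0
  hitLeft_eq_one : hitLeft l Λ = 1

namespace IsDualIntegral

variable {l : H →ₗ[K] K}

omit [Module.Finite K H] in
theorem apply_integral (hl : IsDualIntegral Λ l) : l Λ = 1 := by
  have h := apply_hitRight l ε Λ
  rwa [hl.hitLeft_eq_one, hitRight_counit, Bialgebra.counit_one] at h

theorem hitLeft_eq (hl : IsDualIntegral Λ l) (h : H) : hitLeft l h = l h • (1 : H) := by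
  obtain ⟨f, rfl⟩ := hl.isLeftIntegral.exists_hitRight_eq hl.counit_ne_zero h
  rw [hitLeft_hitRight, apply_hitRight, hl.hitLeft_eq_one, hitRight_apply, Bialgebra.comul_one,
    Algebra.TensorProduct.one_def, contractRight_tmul]

/-- `Λ₁ l(Λ₂)` is the modular element of the dual integral `l`. -/
theorem hitRight_eq (hl : IsDualIntegral Λ l) (h : H) : hitRight l h = l h • hitRight l Λ := by
  obtain ⟨f, rfl⟩ := hl.isLeftIntegral.exists_hitRight_eq hl.counit_ne_zero h
  rw [apply_hitRight, hl.hitLeft_eq_one, hitRight_apply l (hitRight f Λ), ← lTensor_hitRight,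
    hitRight_apply l Λ]
  have key : ∀ z : H ⊗[K] H, contractRight l ((hitRight f).lTensor H z) =
      contractRight f ((hitLeft l).lTensor H z) := by
    intro z
    induction z with
    | zero => simp
    | add x y hx hy => simp only [map_add, hx, hy]
    | tmul x y => simp [apply_hitRight]
  rw [key]
  induction comul (R := K) Λ with
  | zero => simp
  | add x y hx hy => simp only [map_add, hx, hy, smul_add]
  | tmul x y => simp [hl.hitLeft_eq, smul_smul, mul_comm]

theorem isGroupLikeElem (hl : IsDualIntegral Λ l) : IsGroupLikeElem K (hitRight l Λ) where
  counit_eq_one := by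
    rw [apply_hitRight, hitLeft_counit, hl.apply_integral]
  comul_eq_tmul_self := by
    have key : ∀ z : H ⊗[K] H, (hitRight l).lTensor H z = contractRight l z ⊗ₜ hitRight l Λ := by
      intro z
      induction z with
      | zero => simp
      | add x y hx hy => simp only [map_add, add_tmul, hx, hy]
      | tmul x y => rw [LinearMap.lTensor_tmul, contractRight_tmul, hl.hitRight_eq, smul_tmul]
    rw [← lTensor_hitRight, key, ← hitRight_apply]

theorem apply_antipode (hl : IsDualIntegral Λ l) (h : H) : l (S h) = l (h * hitRight l Λ) := by
  set b := hitRight l Λ with hb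
  have hb1 := hl.isGroupLikeElem
  rw [← hb] at hb1
  -- Integrals of the dual on this side are determined by their value at `Λ`. Both `l ∘ S` and `h ↦
  -- l(h b)` are such integrals with the same value there.
  have left_unique : ∀ p q : H →ₗ[K] K, (∀ h, hitRight p h = p h • (1 : H)) →
      (∀ h, hitRight q h = q h • (1 : H)) → p Λ = q Λ → p = q := by
    intro p q hp hq hpq
    ext k
    obtain ⟨f, rfl⟩ := hl.isLeftIntegral.exists_hitLeft_eq hl.counit_ne_zero k
    rw [← apply_hitRight, ← apply_hitRight, hp, hq, hpq]
  have h1 := left_unique (l ∘ₗ S) (l ∘ₗ LinearMap.mulRight K b) ?_ ?_ ?_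
  · simpa using LinearMap.congr_fun h1 h
  · intro k
    apply hl.isLeftIntegral.antipode_injective hl.counit_ne_zero
    rw [← hitLeft_antipode, hl.hitLeft_eq]
    simp
  · intro k
    have h2 := hl.hitRight_eq (k * b)
    rw [← hb, hitRight_apply, Bialgebra.comul_mul, hb1.comul_eq_tmul_self] at h2
    have h3 : ∀ z : H ⊗[K] H, contractRight l (z * b ⊗ₜ b) =
        contractRight (l ∘ₗ LinearMap.mulRight K b) z * b := by
      intro z
      induction z with
      | zero => simp
      | add x y hx hy => simp only [map_add, add_mul, hx, hy]
      | tmul x y => simp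
    rw [h3] at h2
    apply hb1.isUnit.mul_left_injective
    simp only [hitRight_apply, h2]
    simp
  · simp [hl.isLeftIntegral.antipode_eq hl.counit_ne_zero,
      hl.isLeftIntegral.mul_right hl.counit_ne_zero, hb1.counit_eq_one]

end IsDualIntegral

end Integrals

/-! ### The Casimir element, the Frobenius form `l`, and the trace and powers of `S²`. -/

section Casimir

variable {K : Type u} {H : Type v} [Field K] [Ring H] [HopfAlgebra K H] {Λ : H}

local notation "S" => antipode K (A := H)
local notation "ε" => counit (R := K) (A := H)

variable (K) in
/-- The element `Λ₁ ⊗ S(Λ₂)`. -/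
noncomputable def casimir (Λ : H) : H ⊗[K] H := LinearMap.lTensor H S (comul Λ)

theorem mul_casimir (Λ : H) : LinearMap.mul' K H (casimir K Λ) = algebraMap K H (ε Λ) :=
  mul_antipode_lTensor_comul_apply Λ

variable [Module.Finite K H]

theorem IsLeftIntegral.tmul_mul_casimir (hΛ : IsLeftIntegral K H Λ) (hε : ε Λ ≠ 0) (h : H) :
    (h ⊗ₜ 1) * casimir K Λ = casimir K Λ * (1 ⊗ₜ h) := by
  obtain ⟨k, rfl⟩ := hΛ.antipode_surjective hε h
  have h1 : ∀ z : H ⊗[K] H, LinearMap.lTensor H S ((S k ⊗ₜ 1) * z) =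
      (S k ⊗ₜ 1) * LinearMap.lTensor H S z := by
    intro z
    induction z with
    | zero => simp
    | add x y hx hy => simp only [map_add, mul_add, hx, hy]
    | tmul x y => simp
  have h2 : ∀ z : H ⊗[K] H, LinearMap.lTensor H S ((1 ⊗ₜ k) * z) =
      LinearMap.lTensor H S z * (1 ⊗ₜ S k) := by
    intro z
    induction z with
    | zero => simp
    | add x y hx hy => simp only [map_add, mul_add, add_mul, hx, hy]
    | tmul x y => simp [antipode_mul_antidistrib]
  rw [casimir, ← h1, ← hΛ.tmul_mul_comul, h2]

theorem IsLeftIntegral.casimir_mul_tmul (hΛ : IsLeftIntegral K H Λ) (hε : ε Λ ≠ 0) (h : H) :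
    casimir K Λ * (h ⊗ₜ 1) = (1 ⊗ₜ antipodeSq (K := K) h) * casimir K Λ := by
  have h1 : ∀ z : H ⊗[K] H, LinearMap.lTensor H S (z * (h ⊗ₜ 1)) =
      LinearMap.lTensor H S z * (h ⊗ₜ 1) := by
    intro z
    induction z with
    | zero => simp
    | add x y hx hy => simp only [map_add, add_mul, hx, hy]
    | tmul x y => simp
  have h2 : ∀ z : H ⊗[K] H, LinearMap.lTensor H S (z * (1 ⊗ₜ S h)) =
      (1 ⊗ₜ S (S h)) * LinearMap.lTensor H S z := by
    intro z
    induction z with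
    | zero => simp
    | add x y hx hy => simp only [map_add, mul_add, add_mul, hx, hy]
    | tmul x y => simp [antipode_mul_antidistrib]
  rw [casimir, ← h1, comul_mul_tmul (hΛ.mul_right hε), h2, antipodeSq_apply]

namespace IsDualIntegral

variable {l : H →ₗ[K] K}

omit [Module.Finite K H] in
theorem contractLeft_casimir (hl : IsDualIntegral Λ l) : contractLeft l (casimir K Λ) = 1 := by
  rw [casimir, contractLeft_lTensor, ← hitLeft_apply, hl.hitLeft_eq_one, antipode_one]

/-- `l(Λ₁ h) S(Λ₂) = S²(h)`. -/
theorem contractLeft_casimir_mul (hl : IsDualIntegral Λ l) (h : H) :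
    contractLeft l (casimir K Λ * (h ⊗ₜ 1)) = antipodeSq (K := K) h := by
  rw [hl.isLeftIntegral.casimir_mul_tmul hl.counit_ne_zero, contractLeft_one_tmul_mul,
    hl.contractLeft_casimir, mul_one]

theorem eq_zero_of_forall_apply_mul (hl : IsDualIntegral Λ l) {z : H} (hz : ∀ x, l (x * z) = 0) :
    z = 0 := by
  have h1 := hl.contractLeft_casimir_mul z
  have h2 : l ∘ₗ LinearMap.mulRight K z = 0 := by
    ext x
    simpa using hz x
  rw [contractLeft_mul_tmul_one, h2] at h1
  have inj := hl.isLeftIntegral.antipode_injective hl.counit_ne_zero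
  apply inj
  apply inj
  rw [← antipodeSq_apply, ← h1]
  simp [contractLeft]

/-- The Nakayama automorphism of `l` is `S²`. -/
theorem apply_mul_eq (hl : IsDualIntegral Λ l) (y h : H) :
    l (y * h) = l (antipodeSq (K := K) h * y) := by
  -- It suffices to compare the values of `f ↦ f(Λ₁) S(Λ₂)`. The two exchange rules for the Casimir
  -- element give `S²(h)` for both functionals.
  have key : l ∘ₗ LinearMap.mulRight K h = l ∘ₗ LinearMap.mulLeft K (antipodeSq (K := K) h) := by
    apply hl.isLeftIntegral.eq_of_hitLeft_eq hl.counit_ne_zero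
    apply hl.isLeftIntegral.antipode_injective hl.counit_ne_zero
    rw [hitLeft_apply, hitLeft_apply, ← contractLeft_lTensor, ← contractLeft_lTensor]
    change contractLeft _ (casimir K Λ) = contractLeft _ (casimir K Λ)
    rw [← contractLeft_mul_tmul_one, ← contractLeft_tmul_one_mul, hl.contractLeft_casimir_mul,
      hl.isLeftIntegral.tmul_mul_casimir hl.counit_ne_zero, contractLeft_mul_one_tmul,
      hl.contractLeft_casimir, one_mul]
  simpa using LinearMap.congr_fun key y

/-- Radford's formula for `S⁴` in the unimodular case. -/
theorem antipodeSq_antipodeSq_mul (hl : IsDualIntegral Λ l) (w : H) :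
    antipodeSq (K := K) (antipodeSq (K := K) w) * hitRight l Λ = hitRight l Λ * w := by
  set b := hitRight l Λ with hb
  rw [← sub_eq_zero]
  refine hl.eq_zero_of_forall_apply_mul fun x => ?_
  rw [mul_sub, map_sub, sub_eq_zero]
  set y := antipodeSq (K := K) w with hy
  -- Compute `l(S(x) S(y))` twice, directly and after moving `S(y)` to the left by the Nakayama
  -- automorphism; nondegeneracy of `l` then cancels `x`.
  have h1 : l (S x * S y) = l (y * x * b) := by
    rw [← antipode_mul_antidistrib, hl.apply_antipode]
  have h2 : l (S x * S y) = l (x * antipodeSq (K := K) y * b) := by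
    rw [hl.apply_mul_eq, antipodeSq_apply, ← antipode_mul_antidistrib, hl.apply_antipode,
      ← antipodeSq_apply]
  rw [← mul_assoc, ← h2, h1, ← mul_assoc, hl.apply_mul_eq (x * b) w, ← hy, mul_assoc]

/-- For `z = x ⊗ y` the composite is the rank-one map `h ↦ l(x E(h)) y`, of trace `l(x E(y))`. -/
theorem trace_contractLeft_mul (l : H →ₗ[K] K) (E : H →ₗ[K] H) (z : H ⊗[K] H)
    (T : H →ₗ[K] H) (hT : ∀ h, T h = contractLeft l (z * (h ⊗ₜ 1))) :
    LinearMap.trace K H (T ∘ₗ E) = l (LinearMap.mul' K H (E.lTensor H z)) := by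
  let F : H ⊗[K] H →ₗ[K] H →ₗ[K] H := TensorProduct.lift
    (LinearMap.mk₂ K (fun x y => (l ∘ₗ LinearMap.mulLeft K x).smulRight y)
      (by intros; ext; simp [add_mul, add_smul]) (by intros; ext; simp [smul_smul])
      (by intros; ext; simp) (by intros; ext; simp [smul_smul, mul_comm]))
  have hF' : ∀ (z : H ⊗[K] H) (h : H), contractLeft l (z * (h ⊗ₜ 1)) = F z h := by
    intro z h
    induction z with
    | zero => simp
    | add x y hx hy => simp only [map_add, add_mul, LinearMap.add_apply, hx, hy]
    | tmul x y => simp [F]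
  have hF : T = F z := by
    ext h
    rw [hT, hF']
  rw [hF]
  clear hF hF' hT
  induction z with
  | zero => simp
  | add x y hx hy => simp only [map_add, LinearMap.add_comp, hx, hy]
  | tmul x y =>
    have h1 : F (x ⊗ₜ y) ∘ₗ E = (l ∘ₗ LinearMap.mulLeft K x ∘ₗ E).smulRight y := by
      ext; simp [F]
    rw [h1]
    simp

theorem trace_antipodeSq_comp_hitLeft (hl : IsDualIntegral Λ l) (x : H →ₗ[K] K) :
    LinearMap.trace K H ((antipodeSq (K := K)).toLinearMap ∘ₗ hitLeft x) = x Λ * l 1 := by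
  rw [trace_contractLeft_mul l (hitLeft x) (casimir K Λ) _
    fun h => (hl.contractLeft_casimir_mul h).symm]
  -- Passing the contraction through `S` and using coassociativity gives another Casimir element,
  -- whose product is a scalar.
  have h1 : (hitLeft x).lTensor H (casimir K Λ) = casimir K (hitRight (x ∘ₗ S) Λ) := by
    rw [casimir, casimir, ← lTensor_hitRight]
    induction comul (R := K) Λ with
    | zero => simp
    | add x y hx hy => simp only [map_add, hx, hy]
    | tmul x y => simp [hitLeft_antipode]
  rw [h1, mul_casimir, apply_hitRight, hitLeft_counit, LinearMap.comp_apply,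
    hl.isLeftIntegral.antipode_eq hl.counit_ne_zero, Algebra.algebraMap_eq_smul_one, map_smul,
    smul_eq_mul]

theorem trace_antipodeSq (hl : IsDualIntegral Λ l) :
    LinearMap.trace K H (antipodeSq (K := K) (H := H)).toLinearMap = ε Λ * l 1 := by
  have h1 : hitLeft (counit (R := K)) = (LinearMap.id : H →ₗ[K] H) := by ext; simp
  rw [← hl.trace_antipodeSq_comp_hitLeft, h1, LinearMap.comp_id]

/-- Group-like elements are linearly independent, so they form a finite group. -/
theorem exists_pow_hitRight_eq_one (hl : IsDualIntegral Λ l) :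
    ∃ N : ℕ, 0 < N ∧ hitRight l Λ ^ N = 1 := by
  let g : GroupLike K H := ⟨hitRight l Λ, hl.isGroupLikeElem⟩
  have : Finite (GroupLike K H) := (linearIndep_groupLikeVal (R := K) (A := H)).finite
  obtain ⟨N, hN, h⟩ := isOfFinOrder_iff_pow_eq_one.mp (isOfFinOrder_of_finite g)
  exact ⟨N, hN, by simpa [g] using congrArg GroupLike.val h⟩

theorem exists_antipodeSq_iterate (hl : IsDualIntegral Λ l) :
    ∃ N : ℕ, 0 < N ∧ ∀ h, (antipodeSq (K := K) (H := H))^[N] h = h := by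
  obtain ⟨N, hN, hb⟩ := hl.exists_pow_hitRight_eq_one
  refine ⟨2 * N, by omega, fun h => ?_⟩
  have key : ∀ j (h : H), ((antipodeSq (K := K) (H := H))^[2])^[j] h * hitRight l Λ ^ j =
      hitRight l Λ ^ j * h := by
    intro j
    induction j with
    | zero => simp
    | succ j ih =>
      intro h
      rw [Function.iterate_succ', Function.comp_apply, pow_succ', ← mul_assoc]
      change antipodeSq (K := K) (antipodeSq (K := K) _) * _ * _ = _
      rw [hl.antipodeSq_antipodeSq_mul, mul_assoc, ih, mul_assoc]
  have h1 := key N h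
  rwa [hb, mul_one, one_mul, ← Function.iterate_mul] at h1

theorem antipodeSq_antipodeSq (hl : IsDualIntegral Λ l) (h1 : l 1 ≠ 0) (w : H) :
    antipodeSq (K := K) (antipodeSq (K := K) w) = w := by
  -- Evaluating `h₁ l(h₂) = l(h) b` at `h = 1` gives `l(1) • 1 = l(1) • b`.
  have hb : hitRight l Λ = 1 := by
    have h2 := hl.hitRight_eq 1
    rw [hitRight_apply, Bialgebra.comul_one, Algebra.TensorProduct.one_def,
      contractRight_tmul] at h2
    exact (smul_right_injective H h1 h2).symm
  simpa [hb] using hl.antipodeSq_antipodeSq_mul w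

end IsDualIntegral

end Casimir

/-! ### Integrality of traces and a trace criterion for an involution to be trivial. -/

section TraceLemmas

variable {K : Type u} {V : Type v} [Field K] [CharZero K] [AddCommGroup V] [Module K V]
  [Module.Finite K V]

omit [CharZero K] in
theorem exists_nat_trace_of_isIdempotentElem {P : V →ₗ[K] V} (hP : P ∘ₗ P = P) :
    ∃ p : ℕ, LinearMap.trace K V P = p :=
  ⟨_, (LinearMap.IsIdempotentElem.isProj_range P hP).trace⟩

/-- `M` is the difference of the idempotents `(M² + M)/2` and `(M² - M)/2`, whose traces are their
ranks. -/
theorem exists_int_trace_of_comp_comp_eq {M : V →ₗ[K] V} (hM : M ∘ₗ M ∘ₗ M = M) :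
    ∃ j : ℤ, LinearMap.trace K V M = j := by
  have hM' : ∀ v, M (M (M v)) = M v := fun v => LinearMap.congr_fun hM v
  obtain ⟨p, hp⟩ := exists_nat_trace_of_isIdempotentElem
    (P := (2⁻¹ : K) • (M ∘ₗ M + M)) (by
      ext v
      simp only [LinearMap.comp_apply, LinearMap.smul_apply, LinearMap.add_apply, map_smul,
        map_add, hM']
      module)
  obtain ⟨q, hq⟩ := exists_nat_trace_of_isIdempotentElem
    (P := (2⁻¹ : K) • (M ∘ₗ M - M)) (by
      ext v
      simp only [LinearMap.comp_apply, LinearMap.smul_apply, LinearMap.sub_apply, map_smul,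
        map_sub, hM']
      module)
  refine ⟨p - q, ?_⟩
  push_cast
  rw [← hp, ← hq, ← map_sub]
  congr 1
  module

/-- If the eigenvalues `1` and `-1` have multiplicities `p` and `q`, then `p - q = (p + q) j` with
`j ≠ 0`. The fixed vector gives `p > 0`, excluding `j < 0`; then `j ≥ 1` forces `q = 0`. -/
theorem eq_id_of_trace_eq_finrank_mul {T : V →ₗ[K] V} (hT : T ∘ₗ T = LinearMap.id) {v : V}
    (hv : v ≠ 0) (hTv : T v = v) {j : ℤ}
    (hj : LinearMap.trace K V T = (Module.finrank K V : K) * j)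
    (h0 : LinearMap.trace K V T ≠ 0) : T = LinearMap.id := by
  have hT' : ∀ v, T (T v) = v := fun v => LinearMap.congr_fun hT v
  have hP : ((2⁻¹ : K) • (LinearMap.id + T)) ∘ₗ ((2⁻¹ : K) • (LinearMap.id + T)) =
      (2⁻¹ : K) • (LinearMap.id + T) := by
    ext v
    simp only [LinearMap.comp_apply, LinearMap.smul_apply, LinearMap.add_apply, map_smul,
      map_add, hT', LinearMap.id_apply]
    module
  have hQ : ((2⁻¹ : K) • (LinearMap.id - T)) ∘ₗ ((2⁻¹ : K) • (LinearMap.id - T)) =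
      (2⁻¹ : K) • (LinearMap.id - T) := by
    ext v
    simp only [LinearMap.comp_apply, LinearMap.smul_apply, LinearMap.sub_apply, map_smul,
      map_sub, hT', LinearMap.id_apply]
    module
  obtain ⟨p, hp⟩ := exists_nat_trace_of_isIdempotentElem hP
  obtain ⟨q, hq⟩ := exists_nat_trace_of_isIdempotentElem hQ
  have hp0 : p ≠ 0 := by
    rintro rfl
    rw [Nat.cast_zero] at hp
    have h1 := LinearMap.IsIdempotentElem.eq_zero_of_trace_eq_zero (e := _) hP hp
    have h2 := LinearMap.congr_fun h1 v
    simp only [LinearMap.smul_apply, LinearMap.add_apply, LinearMap.id_apply, hTv,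
      LinearMap.zero_apply] at h2
    apply hv
    rw [← h2]
    module
  have hsum : (p : K) + q = Module.finrank K V := by
    rw [← hp, ← hq, ← map_add, ← LinearMap.trace_id K V]
    congr 1
    module
  have hdiff : (p : K) - q = Module.finrank K V * j := by
    rw [← hp, ← hq, ← map_sub, ← hj]
    congr 1
    module
  have hj0 : j ≠ 0 := by
    rintro rfl
    simp [hj] at h0
  have hq0 : q = 0 := by
    rw [← hsum] at hdiff
    have h3 : (p : ℤ) - q = (p + q) * j := by exact_mod_cast hdiff
    have hp1 : (0 : ℤ) < p := by positivity
    have hq1 : (0 : ℤ) ≤ q := by positivity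
    rcases lt_or_gt_of_ne hj0 with h | h
    · nlinarith [mul_nonneg (add_nonneg hp1.le hq1) (by omega : 0 ≤ -1 - j)]
    · have : (q : ℤ) = 0 := by
        nlinarith [mul_nonneg (add_nonneg hp1.le hq1) (by omega : 0 ≤ j - 1)]
      exact_mod_cast this
  subst hq0
  rw [Nat.cast_zero] at hq
  have h1 := LinearMap.IsIdempotentElem.eq_zero_of_trace_eq_zero (e := _) hQ hq
  rw [smul_eq_zero_iff_right (by norm_num), sub_eq_zero] at h1
  exact h1.symm

end TraceLemmas

/-! ### The regular character and the integrality of `l(1)`. -/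

section RegularCharacter

variable {K : Type u} {H : Type v} [Field K] [Ring H] [HopfAlgebra K H] {Λ : H}
  [Module.Finite K H]

local notation "S" => antipode K (A := H)
local notation "ε" => counit (R := K) (A := H)

variable (K H) in
/-- The character of the regular representation. -/
noncomputable def regularCharacter : H →ₗ[K] K := LinearMap.trace K H ∘ₗ LinearMap.mul K H

omit [Module.Finite K H] in
theorem regularCharacter_apply (h : H) :
    regularCharacter K H h = LinearMap.trace K H (LinearMap.mulLeft K h) := rfl

theorem regularCharacter_integral (hΛ : IsLeftIntegral K H Λ) (hε : ε Λ ≠ 0) :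
    regularCharacter K H Λ = ε Λ := by
  rw [regularCharacter_apply]
  have h1 : LinearMap.mulLeft K Λ = (ε).smulRight Λ := by
    ext h
    simp [hΛ.mul_right hε h]
  rw [h1]
  simp

theorem trace_tensorProduct_lmul (z : H ⊗[K] H) :
    LinearMap.trace K (H ⊗[K] H) (LinearMap.mulLeft K z) =
      regularCharacter K H (contractLeft (regularCharacter K H) z) := by
  rw [← regularCharacter_apply]
  induction z with
  | zero => simp
  | add x y hx hy => simp only [map_add, hx, hy]
  | tmul x y =>
    rw [regularCharacter_apply]
    have h1 : LinearMap.mulLeft K (x ⊗ₜ[K] y) =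
        TensorProduct.map (LinearMap.mulLeft K x) (LinearMap.mulLeft K y) := by
      ext; simp
    rw [h1, LinearMap.trace_tensorProduct']
    simp [regularCharacter_apply]

/-- The regular representation absorbs: `H ⊗ H` with the diagonal action is free. -/
theorem trace_comul (h : H) :
    LinearMap.trace K (H ⊗[K] H) (LinearMap.mulLeft K (comul h)) =
      Module.finrank K H * regularCharacter K H h := by
  -- `a ⊗ b ↦ Δ(a)(1 ⊗ b)` carries the action on the first factor alone to the diagonal action; its
  -- inverse comes from `a₁ ⊗ S(a₂) b`.
  let Ψ : H ⊗[K] H →ₗ[K] H ⊗[K] H :=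
    TensorProduct.lift ((LinearMap.mul K (H ⊗[K] H)).compl₁₂ comul (TensorProduct.mk K H H 1))
  have hΨ : ∀ a b, Ψ (a ⊗ₜ b) = comul a * (1 ⊗ₜ b) := fun a b => by simp [Ψ]
  have surj : Function.Surjective Ψ := by
    rw [← LinearMap.range_eq_top, eq_top_iff]
    rintro z -
    induction z with
    | zero => simp
    | add x y hx hy => exact add_mem hx hy
    | tmul a b =>
      refine ⟨∑ i ∈ (ℛ K a).index, (ℛ K a).left i ⊗ₜ (S ((ℛ K a).right i) * b), ?_⟩
      have h1 := congrArg (fun z => z * ((1 : H) ⊗ₜ[K] b)) (sum_comul_mul_tmul_antipode a)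
      simp only [Finset.sum_mul, mul_assoc, Algebra.TensorProduct.tmul_mul_tmul, one_mul,
        mul_one] at h1
      simp only [map_sum, hΨ, h1]
  let e : (H ⊗[K] H) ≃ₗ[K] (H ⊗[K] H) :=
    LinearEquiv.ofBijective Ψ ⟨LinearMap.injective_iff_surjective.mpr surj, surj⟩
  have h2 : LinearMap.mulLeft K (comul h) =
      e.conj (TensorProduct.map (LinearMap.mulLeft K h) LinearMap.id) := by
    have h3 : LinearMap.mulLeft K (comul h) ∘ₗ Ψ =
        Ψ ∘ₗ TensorProduct.map (LinearMap.mulLeft K h) LinearMap.id := by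
      ext a b
      simp [hΨ, Bialgebra.comul_mul, mul_assoc]
    refine LinearMap.ext fun z => ?_
    obtain ⟨y, rfl⟩ := e.surjective z
    rw [LinearEquiv.conj_apply_apply, e.symm_apply_apply]
    exact LinearMap.congr_fun h3 y
  rw [h2, LinearMap.trace_conj', LinearMap.trace_tensorProduct', LinearMap.trace_id, mul_comm]
  rfl

/-- In the dual algebra the regular character satisfies `χ * χ = n χ`, by `trace_comul`. So
`hitLeft` of `χ` is `n` times an idempotent. -/
theorem hitLeft_regularCharacter_hitLeft (h : H) :
    hitLeft (regularCharacter K H) (hitLeft (regularCharacter K H) h) =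
      (Module.finrank K H : K) • hitLeft (regularCharacter K H) h := by
  have h1 : ∀ k : H, regularCharacter K H (hitLeft (regularCharacter K H) k) =
      Module.finrank K H * regularCharacter K H k := by
    intro k
    rw [← trace_comul, trace_tensorProduct_lmul, hitLeft_apply]
  rw [hitLeft_apply, ← rTensor_hitLeft, hitLeft_apply _ h]
  induction comul (R := K) h with
  | zero => simp
  | add x y hx hy => simp only [map_add, hx, hy, smul_add]
  | tmul x y => simp [h1, smul_smul]

omit [Module.Finite K H] in
theorem regularCharacter_antipodeSq (hS : Function.Bijective S) (h : H) :
    regularCharacter K H (antipodeSq (K := K) h) = regularCharacter K H h := by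
  let e : H ≃ₗ[K] H := LinearEquiv.ofBijective (antipodeSq (K := K) (H := H)).toLinearMap
    (hS.comp hS)
  have h1 : LinearMap.mulLeft K (antipodeSq (K := K) h) = e.conj (LinearMap.mulLeft K h) := by
    refine LinearMap.ext fun z => ?_
    obtain ⟨y, rfl⟩ := e.surjective z
    rw [LinearEquiv.conj_apply_apply, e.symm_apply_apply]
    exact (map_mul (antipodeSq (K := K)) h y).symm
  rw [regularCharacter_apply, h1, LinearMap.trace_conj', regularCharacter_apply]

variable [CharZero K] {l : H →ₗ[K] K}

theorem IsDualIntegral.exists_int_apply_one (hl : IsDualIntegral Λ l)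
    (hn : ε Λ = Module.finrank K H) (h1 : l 1 ≠ 0) : ∃ j : ℤ, l 1 = j := by
  set x := regularCharacter K H with hx
  have hn0 : (Module.finrank K H : K) ≠ 0 := hn ▸ hl.counit_ne_zero
  have hS : Function.Bijective S := ⟨hl.isLeftIntegral.antipode_injective hl.counit_ne_zero,
    hl.isLeftIntegral.antipode_surjective hl.counit_ne_zero⟩
  let T := (antipodeSq (K := K) (H := H)).toLinearMap
  have hTT : ∀ h, T (T h) = h := hl.antipodeSq_antipodeSq h1
  have hTE : ∀ h, hitLeft x (T h) = T (hitLeft x h) := by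
    intro h
    have : x ∘ₗ T = x := by
      ext k
      exact regularCharacter_antipodeSq hS k
    have h2 := hitLeft_antipodeSq x h
    rwa [this] at h2
  -- Here `T² = 1`, `T` commutes with `E = hitLeft x`, and `E² = n E`. Hence `M = n⁻¹ T E` satisfies
  -- `M³ = M`, and its trace is `n⁻¹ x(Λ) l(1) = l(1)`.
  obtain ⟨j, hj⟩ := exists_int_trace_of_comp_comp_eq
    (M := (Module.finrank K H : K)⁻¹ • (T ∘ₗ hitLeft x)) (by
      ext h
      simp only [LinearMap.comp_apply, LinearMap.smul_apply, map_smul, hTE, hTT, x,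
        hitLeft_regularCharacter_hitLeft, smul_smul]
      congr 1
      field_simp)
  refine ⟨j, ?_⟩
  rw [← hj, map_smul, hl.trace_antipodeSq_comp_hitLeft,
    regularCharacter_integral hl.isLeftIntegral hl.counit_ne_zero, hn, smul_eq_mul, inv_mul_cancel_left₀ hn0]

/-- In characteristic zero, `S² = 1` as soon as `tr(S²) ≠ 0`. -/
theorem IsDualIntegral.antipodeSq_eq_self (hl : IsDualIntegral Λ l)
    (hn : ε Λ = Module.finrank K H)
    (h0 : LinearMap.trace K H (antipodeSq (K := K) (H := H)).toLinearMap ≠ 0) (h : H) :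
    antipodeSq (K := K) h = h := by
  have ht := hl.trace_antipodeSq
  have h1 : l 1 ≠ 0 := by
    intro h1
    rw [ht, h1, mul_zero] at h0
    exact h0 rfl
  obtain ⟨j, hj⟩ := hl.exists_int_apply_one hn h1
  rw [hn, hj] at ht
  have : Nontrivial H := ⟨1, 0, fun h => h1 (by rw [h, map_zero])⟩
  exact LinearMap.congr_fun (eq_id_of_trace_eq_finrank_mul
    (LinearMap.ext (hl.antipodeSq_antipodeSq h1)) one_ne_zero (by simp) ht h0) h

end RegularCharacter

/-! ### The Casimir element in a matrix representation. -/

section Sandwich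

variable {K : Type u} {H : Type v} [Field K] [Ring H] [HopfAlgebra K H] {Λ : H} {d : ℕ}

local notation "ε" => counit (R := K) (A := H)
local notation "Mat" => Matrix (Fin d) (Fin d) K

/-- `a ⊗ b` acts on matrices by `X ↦ π(a) X π(b)`. -/
noncomputable def sandwich (π : H →ₐ[K] Mat) : H ⊗[K] H →ₗ[K] Mat →ₗ[K] Mat :=
  TensorProduct.lift (LinearMap.mk₂ K
    (fun a b => LinearMap.mulLeft K (π a) ∘ₗ LinearMap.mulRight K (π b))
    (by intros; ext1; simp [add_mul]) (by intros; ext1; simp)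
    (by intros; ext1; simp [mul_add]) (by intros; ext1; simp))

@[simp] theorem sandwich_tmul (π : H →ₐ[K] Mat) (a b : H) (X : Mat) :
    sandwich π (a ⊗ₜ b) X = π a * X * π b := by simp [sandwich, mul_assoc]

theorem sandwich_tmul_one_mul (π : H →ₐ[K] Mat) (h : H) (z : H ⊗[K] H) (X : Mat) :
    sandwich π ((h ⊗ₜ 1) * z) X = π h * sandwich π z X := by
  induction z with
  | zero => simp
  | add x y hx hy => simp only [map_add, mul_add, LinearMap.add_apply, hx, hy]
  | tmul x y => simp [mul_assoc]

theorem sandwich_one_tmul_mul (π : H →ₐ[K] Mat) (h : H) (z : H ⊗[K] H) (X : Mat) :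
    sandwich π ((1 ⊗ₜ h) * z) X = sandwich π z (X * π h) := by
  induction z with
  | zero => simp
  | add x y hx hy => simp only [map_add, mul_add, LinearMap.add_apply, hx, hy]
  | tmul x y => simp [mul_assoc]

theorem sandwich_mul_tmul_one (π : H →ₐ[K] Mat) (h : H) (z : H ⊗[K] H) (X : Mat) :
    sandwich π (z * (h ⊗ₜ 1)) X = sandwich π z (π h * X) := by
  induction z with
  | zero => simp
  | add x y hx hy => simp only [map_add, add_mul, LinearMap.add_apply, hx, hy]
  | tmul x y => simp [mul_assoc]

theorem sandwich_mul_one_tmul (π : H →ₐ[K] Mat) (h : H) (z : H ⊗[K] H) (X : Mat) :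
    sandwich π (z * (1 ⊗ₜ h)) X = sandwich π z X * π h := by
  induction z with
  | zero => simp
  | add x y hx hy => simp only [map_add, add_mul, LinearMap.add_apply, hx, hy]
  | tmul x y => simp [mul_assoc]

theorem sandwich_one (π : H →ₐ[K] Mat) (z : H ⊗[K] H) :
    sandwich π z 1 = π (LinearMap.mul' K H z) := by
  induction z with
  | zero => simp
  | add x y hx hy => simp only [map_add, LinearMap.add_apply, hx, hy]
  | tmul x y => simp

theorem exists_eq_smul_one_of_commute {X : Mat} (hX : ∀ A, A * X = X * A) : ∃ c : K, X = c • 1 := by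
  obtain ⟨c, hc⟩ := Matrix.mem_range_scalar_iff_commute_single'.mpr fun i j => hX _
  exact ⟨c, by rw [← hc, Matrix.scalar_apply, Matrix.smul_one_eq_diagonal]⟩

theorem exists_trace_mul (f : Mat →ₗ[K] K) : ∃ t : Mat, ∀ X, f X = (t * X).trace := by
  refine ⟨Matrix.of fun i j => f (Matrix.single j i 1), fun X => ?_⟩
  conv_lhs => rw [Matrix.matrix_eq_sum_single X]
  simp only [map_sum, Matrix.trace, Matrix.diag_apply, Matrix.mul_apply, Matrix.of_apply]
  rw [Finset.sum_comm]
  refine Finset.sum_congr rfl fun i _ => Finset.sum_congr rfl fun j _ => ?_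
  rw [mul_comm, ← smul_eq_mul, ← map_smul, Matrix.smul_single, smul_eq_mul, mul_one]

/-- The kernel of `t` is stable under all matrices, so a nonzero kernel vector can be moved to every
basis vector, killing every column of `t`. -/
theorem isUnit_of_mul_eq {t : Mat} (ht : t ≠ 0) (h : ∀ A : Mat, ∃ B : Mat, t * A = B * t) :
    IsUnit t := by
  rw [Matrix.isUnit_iff_isUnit_det, isUnit_iff_ne_zero]
  intro h0
  obtain ⟨v, hv, htv⟩ := Matrix.exists_mulVec_eq_zero_iff.mpr h0
  obtain ⟨i, hi⟩ := Function.ne_iff.mp hv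
  apply ht
  ext a b
  obtain ⟨B, hB⟩ := h (Matrix.single b i (v i)⁻¹)
  have h1 : t.mulVec ((Matrix.single b i (v i)⁻¹).mulVec v) = 0 := by
    rw [Matrix.mulVec_mulVec, hB, ← Matrix.mulVec_mulVec, htv, Matrix.mulVec_zero]
  have h2 : (Matrix.single b i (v i)⁻¹).mulVec v = Pi.single b 1 := by
    ext c
    rw [Matrix.single_mulVec]
    simp at hi
    by_cases hc : c = b
    · subst hc; simp [hi]
    · simp [hc]
  rw [h2, Matrix.mulVec_single_one] at h1
  exact congrFun h1 a

variable [Module.Finite K H]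

/-- The image of the Casimir element under a matrix representation is a twisted trace. -/
theorem IsLeftIntegral.exists_twist [NeZero d] (hΛ : IsLeftIntegral K H Λ) (hε : ε Λ ≠ 0)
    {π : H →ₐ[K] Mat} (hπ : Function.Surjective π) :
    ∃ t : Mat, IsUnit t ∧ t.trace = ε Λ ∧ (∀ h, t * π h = π (antipodeSq (K := K) h) * t) ∧
      ∀ X, sandwich π (casimir K Λ) X = (t * X).trace • 1 := by
  set F := sandwich π (casimir K Λ) with hF
  -- The exchange rule makes `F X` commute with the image of `π`, which is the full matrix algebra.
  have hscalar : ∀ X, F X = F X 0 0 • 1 := by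
    intro X
    obtain ⟨c, hc⟩ := exists_eq_smul_one_of_commute (X := F X) (by
      intro A
      obtain ⟨h, rfl⟩ := hπ A
      rw [hF, ← sandwich_tmul_one_mul, hΛ.tmul_mul_casimir hε, sandwich_mul_one_tmul])
    rw [hc]
    simp
  obtain ⟨t, ht⟩ := exists_trace_mul (Matrix.entryLinearMap K K 0 0 ∘ₗ F)
  have ht' : ∀ X, F X 0 0 = (t * X).trace := ht
  have htr : t.trace = ε Λ := by
    rw [← mul_one t, ← ht', hF, sandwich_one, mul_casimir, AlgHom.commutes,
      Matrix.algebraMap_matrix_apply]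
    simp
  have hcomm : ∀ h, t * π h = π (antipodeSq (K := K) h) * t := by
    intro h
    rw [Matrix.ext_iff_trace_mul_right]
    intro X
    rw [mul_assoc, ← ht', mul_assoc, Matrix.trace_mul_comm, mul_assoc, ← ht', hF,
      ← sandwich_mul_tmul_one, hΛ.casimir_mul_tmul hε, sandwich_one_tmul_mul]
  refine ⟨t, isUnit_of_mul_eq ?_ ?_, htr, hcomm, fun X => by rw [hscalar, ht']⟩
  · rintro rfl
    rw [Matrix.trace_zero] at htr
    exact hε htr.symm
  · intro A
    obtain ⟨h, rfl⟩ := hπ A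
    exact ⟨_, hcomm h⟩

omit [Module.Finite K H] in
-- Conjugation by `t` implements `S²`, so `t ^ N` implements the identity and is central.
theorem pow_eq_smul_one_of_twist {π : H →ₐ[K] Mat} (hπ : Function.Surjective π) {t : Mat}
    (ht : ∀ h, t * π h = π (antipodeSq (K := K) h) * t) {N : ℕ}
    (hN : ∀ h, (antipodeSq (K := K) (H := H))^[N] h = h) : ∃ c : K, t ^ N = c • 1 := by
  have key : ∀ j h, t ^ j * π h = π ((antipodeSq (K := K))^[j] h) * t ^ j := by
    intro j
    induction j with
    | zero => simp
    | succ j ih =>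
      intro h
      rw [Function.iterate_succ', Function.comp_apply, pow_succ', mul_assoc, ih, ← mul_assoc, ht,
        mul_assoc]
  refine exists_eq_smul_one_of_commute fun A => ?_
  obtain ⟨h, rfl⟩ := hπ A
  rw [key, hN]

theorem trace_mulLeft_comp_mulRight (A B : Mat) :
    LinearMap.trace K Mat (LinearMap.mulLeft K A ∘ₗ LinearMap.mulRight K B) =
      A.trace * B.trace := by
  rw [LinearMap.trace_eq_matrix_trace K (Matrix.stdBasis K (Fin d) (Fin d))]
  simp only [Matrix.trace, Matrix.diag_apply, LinearMap.toMatrix_apply, Fintype.sum_prod_type,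
    Matrix.stdBasis_eq_single, LinearMap.comp_apply, LinearMap.mulRight_apply,
    LinearMap.mulLeft_apply, Finset.sum_mul_sum]
  refine Finset.sum_congr rfl fun i _ => Finset.sum_congr rfl fun j _ => ?_
  have hrepr : ∀ X : Mat, (Matrix.stdBasis K (Fin d) (Fin d)).repr X (i, j) = X i j := fun X => by
    simp [Matrix.stdBasis]
  rw [hrepr, ← mul_assoc, Matrix.mul_apply, Finset.sum_eq_single j]
  · simp
  · intro k _ hk
    rw [Matrix.mul_single_apply_of_ne _ _ _ _ _ hk, zero_mul]
  · simp

theorem trace_pi {ι : Type*} [Fintype ι] [DecidableEq ι] {V : ι → Type*}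
    [∀ i, AddCommGroup (V i)] [∀ i, Module K (V i)] [∀ i, Module.Finite K (V i)]
    (G : (∀ i, V i) →ₗ[K] ∀ i, V i) :
    LinearMap.trace K _ G =
      ∑ i, LinearMap.trace K _ (LinearMap.proj i ∘ₗ G ∘ₗ LinearMap.single K V i) := by
  have h1 : G = ∑ i, (G ∘ₗ LinearMap.single K V i) ∘ₗ LinearMap.proj i := by
    refine LinearMap.ext fun v => ?_
    simp only [LinearMap.sum_apply, LinearMap.comp_apply, LinearMap.proj_apply, ← map_sum,
      LinearMap.single_apply, Finset.univ_sum_single]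
  conv_lhs => rw [h1, map_sum]
  refine Finset.sum_congr rfl fun i _ => ?_
  rw [LinearMap.trace_comp_comm']

end Sandwich

/-! ### Positivity of `tr(t) tr(t⁻¹)` for `t` of finite order up to scalars. -/

section FiniteOrder

variable {K : Type u} [Field K] [IsAlgClosed K] [CharZero K]

open Polynomial in
/-- An endomorphism of finite order is diagonalizable; its powers have traces given by the
eigenvalues, which are roots of unity. -/
theorem exists_trace_pow_eq_sum {V : Type v} [AddCommGroup V] [Module K V] [Module.Finite K V]
    {s : Module.End K V} {N : ℕ} (hN : 0 < N) (hs : s ^ N = 1) :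
    ∃ (I : Finset K) (m : K → ℕ), (∀ μ ∈ I, μ ^ N = 1) ∧
      ∀ k, LinearMap.trace K V (s ^ k) = ∑ μ ∈ I, m μ * μ ^ k := by
  classical
  have hss : s.IsSemisimple := by
    refine Module.End.isSemisimple_of_squarefree_aeval_eq_zero (p := X ^ N - 1) ?_ (by simp [hs])
    have := Polynomial.X_pow_sub_one_separable_iff (F := K) (n := N)
    exact (this.mpr (by exact_mod_cast hN.ne')).squarefree
  have hint : DirectSum.IsInternal fun μ => s.eigenspace μ :=
    DirectSum.isInternal_submodule_of_iSupIndep_of_iSup_eq_top s.eigenspaces_iSupIndep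
      hss.iSup_eigenspace_eq_top
  have hfin : {μ | s.eigenspace μ ≠ ⊥}.Finite :=
    WellFoundedGT.finite_ne_bot_of_iSupIndep s.eigenspaces_iSupIndep
  have hpow : ∀ (k : ℕ) (μ : K), ∀ v ∈ s.eigenspace μ, (s ^ k) v = μ ^ k • v := by
    intro k μ v hv
    rw [Module.End.mem_eigenspace_iff] at hv
    induction k with
    | zero => simp
    | succ k ih => rw [pow_succ', Module.End.mul_apply, ih, map_smul, hv, smul_smul, pow_succ]
  have hmaps : ∀ (k : ℕ) (μ : K), Set.MapsTo (⇑(s ^ k)) (s.eigenspace μ : Set V) (s.eigenspace μ : Set V) := by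
    intro k μ v hv
    rw [SetLike.mem_coe] at hv ⊢
    rw [hpow k μ v hv]
    exact Submodule.smul_mem _ _ hv
  refine ⟨hfin.toFinset, fun μ => Module.finrank K (s.eigenspace μ), ?_, ?_⟩
  · intro μ hμ
    rw [Set.Finite.mem_toFinset, Set.mem_ofPred_eq, Submodule.ne_bot_iff] at hμ
    obtain ⟨v, hv, hv0⟩ := hμ
    have h1 := hpow N μ v hv
    rw [hs, Module.End.one_apply] at h1
    exact smul_left_injective K hv0 (by simpa using h1.symm)
  · intro k
    rw [LinearMap.trace_eq_sum_trace_restrict' hint hfin (hmaps k)]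
    refine Finset.sum_congr rfl fun μ _ => ?_
    have h1 : (s ^ k).restrict (hmaps k μ) = μ ^ k • LinearMap.id := by
      ext v
      exact hpow k μ v v.2
    rw [h1, map_smul, LinearMap.trace_id, smul_eq_mul, mul_comm]

/-- If `t` has finite order up to scalars and nonzero trace, then `tr(t) tr(t⁻¹)` is positive under
every complex embedding. -/
theorem exists_trace_mul_trace_inv_pos {d : ℕ} {t : Matrix (Fin d) (Fin d) K} (ht : IsUnit t)
    {N : ℕ} (hN : 0 < N) {c : K} (hc : t ^ N = c • 1) (htr : t.trace ≠ 0)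
    (φ : algebraicClosure ℚ K →+* ℂ) :
    ∃ e : algebraicClosure ℚ K, (e : K) = t.trace * t⁻¹.trace ∧ ∃ r : ℝ, 0 < r ∧ φ e = r := by
  have hd : Nonempty (Fin d) := by
    by_contra h
    rw [not_nonempty_iff] at h
    simp [Matrix.trace] at htr
  have hc0 : c ≠ 0 := by
    rintro rfl
    rw [zero_smul] at hc
    exact (ht.pow N).ne_zero hc
  -- Rescaling by an `N`-th root of `c` gives `s ^ N = 1` without changing the product `tr(t)
  -- tr(t⁻¹)`.
  obtain ⟨r, hr⟩ := IsAlgClosed.exists_pow_nat_eq c hN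
  have hr0 : r ≠ 0 := by
    rintro rfl
    exact hc0 (by rw [← hr, zero_pow hN.ne'])
  set s := r⁻¹ • t with hsdef
  have hs : s ^ N = 1 := by
    rw [hsdef, smul_pow, hc, smul_smul, inv_pow, hr, inv_mul_cancel₀ hc0, one_smul]
  have hinv : t⁻¹ = r⁻¹ • s ^ (N - 1) := by
    refine Matrix.inv_eq_right_inv ?_
    rw [mul_smul_comm, ← smul_mul_assoc, ← hsdef, ← pow_succ', Nat.sub_add_cancel hN, hs]
  obtain ⟨I, m, hI, hm⟩ := exists_trace_pow_eq_sum (s := Matrix.toLin' s) hN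
    (by rw [← Matrix.toLin'_pow, hs, Matrix.toLin'_one]; rfl)
  have hm' : ∀ k, (s ^ k).trace = ∑ μ ∈ I, m μ * μ ^ k := by
    intro k
    rw [← hm, ← Matrix.toLin'_pow, Matrix.trace_toLin'_eq]
  have hprod : t.trace * t⁻¹.trace = (s ^ 1).trace * (s ^ (N - 1)).trace := by
    rw [hinv, pow_one, hsdef, Matrix.trace_smul, Matrix.trace_smul, smul_eq_mul, smul_eq_mul,
      mul_left_comm, mul_assoc]
  have halg : ∀ μ ∈ I, μ ∈ algebraicClosure ℚ K := by
    intro μ hμ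
    rw [mem_algebraicClosure_iff]
    refine IsIntegral.isAlgebraic (IsIntegral.of_pow hN ?_)
    rw [hI μ hμ]
    exact isIntegral_one
  let y : ℕ → algebraicClosure ℚ K := fun k => ∑ μ ∈ I.attach, m μ * ⟨μ, halg μ μ.2⟩ ^ k
  have hy : ∀ k, (y k : K) = (s ^ k).trace := by
    intro k
    rw [hm', ← Finset.sum_attach]
    simp [y]
  -- The eigenvalues of `s` are roots of unity, so `μ ^ (N - 1) = μ⁻¹` maps to the complex conjugate
  -- of `φ μ`; the product of the traces becomes `|φ (tr s)|²`.
  have hconj : φ (y (N - 1)) = (starRingEnd ℂ) (φ (y 1)) := by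
    simp only [y, map_sum, map_mul, map_pow, map_natCast, pow_one]
    refine Finset.sum_congr rfl fun μ _ => ?_
    congr 1
    have h1 : φ ⟨μ, halg μ μ.2⟩ ^ N = 1 := by
      rw [← map_pow, ← map_one φ]
      congr 1
      exact Subtype.ext (hI μ μ.2)
    rw [← Complex.inv_eq_conj (Complex.norm_eq_one_of_pow_eq_one h1 hN.ne')]
    refine eq_inv_of_mul_eq_one_left ?_
    rw [← pow_succ, Nat.sub_add_cancel hN, h1]
  refine ⟨y 1 * y (N - 1), ?_, Complex.normSq (φ (y 1)), ?_, ?_⟩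
  · rw [hprod, ← hy, ← hy]
    rfl
  · rw [Complex.normSq_pos]
    intro h0
    have h1 : y 1 = 0 := φ.injective (h0.trans (map_zero φ).symm)
    have h2 := hy 1
    rw [h1, pow_one, hsdef, Matrix.trace_smul] at h2
    exact smul_ne_zero (inv_ne_zero hr0) htr h2.symm
  · rw [map_mul, hconj, Complex.mul_conj]

end FiniteOrder

/-! ### The Larson–Radford theorem. -/

section Semisimple

variable {K : Type u} {H : Type v} [Field K] [Ring H] [HopfAlgebra K H] {Λ : H}
  [Module.Finite K H] [IsAlgClosed K] [CharZero K] [IsSemisimpleRing H]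

local notation "ε" => counit (R := K) (A := H)

theorem IsDualIntegral.trace_antipodeSq_ne_zero {l : H →ₗ[K] K} (hl : IsDualIntegral Λ l) :
    LinearMap.trace K H (antipodeSq (K := K) (H := H)).toLinearMap ≠ 0 := by
  obtain ⟨N, hN, hfix⟩ := hl.exists_antipodeSq_iterate
  obtain ⟨k, d, hd, ⟨e⟩⟩ := IsSemisimpleRing.exists_algEquiv_pi_matrix_of_isAlgClosed K H
  let π : ∀ i, H →ₐ[K] Matrix (Fin (d i)) (Fin (d i)) K := fun i =>
    (Pi.evalAlgHom K (fun i => Matrix (Fin (d i)) (Fin (d i)) K) i).comp e.toAlgHom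
  have hπ : ∀ i, Function.Surjective (π i) := fun i =>
    (Function.surjective_eval i).comp e.surjective
  choose t ht htr hcomm _ using fun i =>
    hl.isLeftIntegral.exists_twist hl.counit_ne_zero (hπ i)
  have htrace : LinearMap.trace K H (antipodeSq (K := K) (H := H)).toLinearMap =
      ∑ i, (t i).trace * (t i)⁻¹.trace := by
    -- Only the diagonal blocks count, and on the `i`-th one `S²` is `X ↦ tᵢ X tᵢ⁻¹`.
    rw [← LinearMap.trace_conj' _ e.toLinearEquiv, trace_pi]
    refine Finset.sum_congr rfl fun i _ => ?_
    rw [← trace_mulLeft_comp_mulRight]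
    congr 1
    refine LinearMap.ext fun X => ?_
    have h1 := hcomm i (e.symm (Pi.single i X))
    have h2 : π i (e.symm (Pi.single i X)) = X := by simp [π]
    rw [h2] at h1
    change π i (antipodeSq (K := K) (e.symm (Pi.single i X))) = t i * (X * (t i)⁻¹)
    rw [← mul_assoc, h1, mul_assoc,
      Matrix.mul_nonsing_inv _ ((Matrix.isUnit_iff_isUnit_det _).mp (ht i)), mul_one]
  have hne : Nonempty (Fin k) := by
    by_contra hk
    rw [not_nonempty_iff] at hk
    have : Subsingleton H := e.injective.subsingleton
    exact hl.counit_ne_zero (by rw [Subsingleton.elim Λ 0, map_zero])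
  -- `K` itself may be too large to embed in `ℂ`, but the subfield of algebraic numbers, which
  -- contains all the summands, does embed.
  let _ : Algebra ℚ (algebraicClosure ℚ K) := (algebraicClosure ℚ K).algebra'
  have : Algebra.IsAlgebraic ℚ (algebraicClosure ℚ K) := algebraicClosure.isAlgebraic ℚ K
  let φ : algebraicClosure ℚ K →+* ℂ :=
    (IsAlgClosed.lift : algebraicClosure ℚ K →ₐ[ℚ] ℂ).toRingHom
  have hpos : ∀ i, ∃ y : algebraicClosure ℚ K, (y : K) = (t i).trace * (t i)⁻¹.trace ∧
      ∃ r : ℝ, 0 < r ∧ φ y = r := by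
    intro i
    obtain ⟨c, hc⟩ := pow_eq_smul_one_of_twist (hπ i) (hcomm i) hfix
    exact exists_trace_mul_trace_inv_pos (ht i) hN hc (by rw [htr]; exact hl.counit_ne_zero) φ
  choose y hy r hr hφ using hpos
  intro h0
  have h1 : ∑ i, y i = 0 := by
    apply Subtype.ext
    rw [htrace] at h0
    simpa [hy] using h0
  have h2 : ∑ i, r i = 0 := by
    have h3 := congrArg φ h1
    simp only [map_sum, hφ, map_zero] at h3
    exact_mod_cast h3
  exact (Finset.sum_pos (fun i _ => hr i) Finset.univ_nonempty).ne' h2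

omit [IsAlgClosed K] [IsSemisimpleRing H] in
variable (K H) in
theorem finrank_cast_ne_zero : (Module.finrank K H : K) ≠ 0 := by
  have : Nontrivial H := by
    by_contra h
    rw [not_nontrivial_iff_subsingleton] at h
    have h1 := Bialgebra.counit_one (R := K) (A := H)
    rw [Subsingleton.elim (1 : H) 0, map_zero] at h1
    exact zero_ne_one h1
  exact_mod_cast (Module.finrank_pos (R := K) (M := H)).ne'

/-- The **Larson–Radford theorem**: the antipode of a semisimple Hopf algebra in characteristic
zero is an involution. -/
theorem antipodeSq_eq_self (h : H) : antipodeSq (K := K) h = h := by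
  obtain ⟨hΛ, hn⟩ := integral_spec K H
  have hε : ε (integral K H) ≠ 0 := hn ▸ finrank_cast_ne_zero K H
  obtain ⟨l, hl⟩ := hΛ.exists_hitLeft_eq hε 1
  have hl' : IsDualIntegral (integral K H) l := ⟨hΛ, hε, hl⟩
  exact hl'.antipodeSq_eq_self hn hl'.trace_antipodeSq_ne_zero h

end Semisimple

/-! ### The action of `ν` on the tensor square of an irreducible representation, and integrality. -/

section Representation

variable {K : Type u} {H : Type v} [Field K] [Ring H]

theorem exists_surjective_matrix [Algebra K H] [IsAlgClosed K] [Module.Finite K H]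
    (M : Type w) [AddCommGroup M] [Module K M] [Module H M] [IsScalarTower K H M]
    [IsSimpleModule H M] :
    ∃ π : H →ₐ[K] Matrix (Fin (Module.finrank K M)) (Fin (Module.finrank K M)) K,
      Function.Surjective π ∧ NeZero (Module.finrank K M) := by
  have : Module.Finite K M := Module.Finite.trans H M
  have : Nontrivial M := IsSimpleModule.nontrivial H M
  let b := Module.finBasis K M
  refine ⟨(LinearMap.toMatrixAlgEquiv b).toAlgHom.comp (Algebra.lsmul K K M),
    (LinearMap.toMatrixAlgEquiv b).surjective.comp ?_, ⟨Module.finrank_pos.ne'⟩⟩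
  intro f
  -- By Schur's lemma the `H`-endomorphisms of `M` are scalars, so every `K`-linear `f` commutes
  -- with them and the density theorem applies on a basis.
  have hcomm : ∀ (g : Module.End H M) (m : M), f (g • m) = g • f m := by
    intro g m
    obtain ⟨c, rfl⟩ := (IsSimpleModule.algebraMap_end_bijective_of_isAlgClosed K).2 g
    simp
  classical
  obtain ⟨r, hr⟩ := jacobson_density (R := H) (M := M)
    { toFun := f, map_add' := f.map_add, map_smul' := hcomm } (Finset.univ.image b)
  refine ⟨r, b.ext fun i => ?_⟩
  exact (hr (b i) (Finset.mem_image_of_mem _ (Finset.mem_univ i))).symm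

variable {d : ℕ}

local notation "Mat" => Matrix (Fin d) (Fin d) K

/-- `a ⊗ b` acts on matrices by `X ↦ π(a) X π(b)ᵀ`. -/
noncomputable def tensorAction [Algebra K H] (π : H →ₐ[K] Mat) :
    H ⊗[K] H →ₐ[K] Module.End K Mat :=
  Algebra.TensorProduct.lift ((Algebra.lmul K Mat).comp π)
    (AlgHom.ofLinearMap
      { toFun := fun b => LinearMap.mulRight K (π b).transpose
        map_add' := by intros; ext1; simp [mul_add]
        map_smul' := by intros; ext1; simp }
      (by ext1; simp)
      (by intros; refine LinearMap.ext fun X => ?_; simp [mul_assoc]))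
    (by
      intro a b
      rw [commute_iff_eq]
      refine LinearMap.ext fun X => ?_
      simp [mul_assoc])

theorem tensorAction_tmul [Algebra K H] (π : H →ₐ[K] Mat) (a b : H) (X : Mat) :
    tensorAction π (a ⊗ₜ b) X = π a * X * (π b).transpose := by
  rw [tensorAction, Algebra.TensorProduct.lift_tmul]
  simp [mul_assoc]

/-- For `z = a ⊗ b` both entries are `π(a)ₖᵢ π(b)ₗⱼ`. This partial transpose turns the trace formula
for the sandwich into a multiple of the flip. -/
theorem tensorAction_single [HopfAlgebra K H] (π : H →ₐ[K] Mat) (z : H ⊗[K] H) (i j k l : Fin d) :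
    tensorAction π z (Matrix.single i j 1) k l = sandwich π z (Matrix.single i l 1) k j := by
  induction z with
  | zero => simp
  | add x y hx hy => simp only [map_add, LinearMap.add_apply, Matrix.add_apply, hx, hy]
  | tmul a b =>
    rw [tensorAction_tmul, sandwich_tmul]
    simp [Matrix.mul_apply, Matrix.single, Finset.sum_ite_eq, ite_and]

variable [HopfAlgebra K H] [Module.Finite K H] [IsAlgClosed K] [CharZero K] [IsSemisimpleRing H]

theorem exists_tensorAction_nu_mul_self [NeZero d] {π : H →ₐ[K] Mat} (hπ : Function.Surjective π) :
    ∃ c : K, c * d = Module.finrank K H ∧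
      tensorAction π (nu K H) * tensorAction π (nu K H) = c ^ 2 • 1 := by
  obtain ⟨hΛ, hn⟩ := integral_spec K H
  obtain ⟨t, -, htr, hcomm, hF⟩ := hΛ.exists_twist (hn ▸ finrank_cast_ne_zero K H) hπ
  -- Larson–Radford enters here: with `S² = 1` the twist commutes with every matrix.
  obtain ⟨c, rfl⟩ := exists_eq_smul_one_of_commute (X := t) (by
    intro A
    obtain ⟨h, rfl⟩ := hπ A
    rw [hcomm, antipodeSq_eq_self])
  have hact : ∀ X, tensorAction π (nu K H) X = c • X.transpose := by
    have h1 : tensorAction π (nu K H) =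
        c • (Matrix.transposeLinearEquiv (Fin d) (Fin d) K K).toLinearMap := by
      refine (Matrix.stdBasis K (Fin d) (Fin d)).ext fun ⟨i, j⟩ => ?_
      rw [Matrix.stdBasis_eq_single]
      ext k l
      rw [tensorAction_single]
      change sandwich π (casimir K (integral K H)) _ _ _ = _
      rw [hF]
      rcases eq_or_ne i l with rfl | h1 <;> rcases eq_or_ne k j with rfl | h2 <;>
        simp [*, Ne.symm, Matrix.trace_single_eq_of_ne]
    intro X
    rw [h1]
    rfl
  refine ⟨c, ?_, LinearMap.ext fun X => ?_⟩
  · rw [← hn, ← htr]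
    simp
  · simp [hact, smul_smul, pow_two]

omit [Module.Finite K H] [IsAlgClosed K] [CharZero K] in
theorem isIntegral_of_isWeakForm [NeZero d] {π : H →ₐ[K] Mat} {R : Subring K}
    (hR : HasWeakForm K H R) {c : K} (hc0 : c ≠ 0)
    (hc : tensorAction π (nu K H) * tensorAction π (nu K H) = c • 1) : IsIntegral R c := by
  obtain ⟨-, x, -, hm, hν⟩ := hR
  let ρ := tensorAction π
  -- The image of the `R`-form of `H ⊗ H`: finitely generated over `R`, and stable under `ρ(ν)`
  -- because `ν` and the products have coefficients in `R`.
  let N : Submodule R (Module.End K Mat) :=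
    Submodule.span R (Set.range fun p : _ × _ => ρ (x p.1 ⊗ₜ x p.2))
  have smul_mem : ∀ r ∈ R, ∀ f ∈ N, r • f ∈ N := fun r hr f hf => N.smul_mem (⟨r, hr⟩ : R) hf
  have gen_mem : ∀ i j, ρ (x i ⊗ₜ x j) ∈ N := fun i j => Submodule.subset_span ⟨(i, j), rfl⟩
  have hνeq : nu K H = ∑ p : _ × _, (x.tensorProduct x).repr (nu K H) p • (x p.1 ⊗ₜ[K] x p.2) := by
    conv_lhs => rw [← (x.tensorProduct x).sum_repr (nu K H)]
    simp [Module.Basis.tensorProduct_apply']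
  have mul_mem : ∀ f ∈ N, ρ (nu K H) * f ∈ N := by
    intro f hf
    induction hf using Submodule.span_induction with
    | zero => simp
    | add f g _ _ hf hg => rw [mul_add]; exact add_mem hf hg
    | smul r f _ hf => rw [mul_smul_comm]; exact N.smul_mem r hf
    | mem f hf =>
      obtain ⟨⟨k, l⟩, rfl⟩ := hf
      simp only
      rw [← map_mul, hνeq, Finset.sum_mul, map_sum]
      refine sum_mem fun p _ => ?_
      rw [smul_mul_assoc, map_smul]
      refine smul_mem _ (hν _ _) _ ?_
      rw [Algebra.TensorProduct.tmul_mul_tmul, ← x.sum_repr (x p.1 * x k),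
        ← x.sum_repr (x p.2 * x l), sum_tmul, map_sum]
      refine sum_mem fun a _ => ?_
      rw [tmul_sum, map_sum]
      refine sum_mem fun b _ => ?_
      rw [← smul_tmul', tmul_smul, map_smul, map_smul]
      exact smul_mem _ (hm _ _ _) _ (smul_mem _ (hm _ _ _) _ (gen_mem a b))
  have nu_mem : ρ (nu K H) ∈ N := by
    rw [hνeq, map_sum]
    refine sum_mem fun p _ => ?_
    rw [map_smul]
    exact smul_mem _ (hν _ _) _ (gen_mem _ _)
  -- `N` is nonzero because it contains `ρ(ν)²`, a nonzero scalar; multiplying twice by `ρ(ν)` shows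
  -- `c • N ⊆ N`.
  refine isIntegral_of_smul_mem_submodule N ?_ (Submodule.fg_span (Set.finite_range _)) c ?_
  · intro hN
    have h1 := mul_mem _ nu_mem
    rw [hN, Submodule.mem_bot] at h1
    exact smul_ne_zero hc0 one_ne_zero (hc.symm.trans h1)
  · intro f hf
    have h1 := mul_mem _ (mul_mem f hf)
    rwa [← mul_assoc, hc, smul_one_mul] at h1

end Representation

theorem dvd_of_isIntegral_of_mul_eq {K : Type u} [Field K] [CharZero K] {c : K}
    (hc : IsIntegral ℤ c) {d n : ℕ} (hd : d ≠ 0) (h : c * d = n) : d ∣ n := by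
  have hd' : (d : K) ≠ 0 := by exact_mod_cast hd
  have h1 : c = algebraMap ℚ K (n / d) := by
    rw [map_div₀, map_natCast, map_natCast, eq_div_iff hd', h]
  rw [h1, isIntegral_algebraMap_iff (algebraMap ℚ K).injective] at hc
  obtain ⟨z, hz⟩ := IsIntegrallyClosed.isIntegral_iff.mp hc
  rw [eq_intCast, eq_div_iff (by exact_mod_cast hd)] at hz
  have h2 : z * (d : ℤ) = n := by exact_mod_cast hz
  exact Int.natCast_dvd_natCast.mp ⟨z, by rw [← h2, mul_comm]⟩

end HopfWeakForm

theorem corollary4 (K : Type u) [Field K] [IsAlgClosed K] [CharZero K]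
    (H : Type v) [Ring H] [HopfAlgebra K H] [Module.Finite K H] [IsSemisimpleRing H]
    (L : Subfield K) [NumberField L]
    (hH : HopfWeakForm.HasWeakForm K H ((integralClosure ℤ K).toSubring ⊓ L.toSubring)) :
    HopfWeakForm.IsOfFrobeniusType.{u, v, w} K H := by
  intro M _ _ _ _ _
  obtain ⟨π, hπ, hd⟩ := HopfWeakForm.exists_surjective_matrix (K := K) (H := H) M
  obtain ⟨c, hcd, hc⟩ := HopfWeakForm.exists_tensorAction_nu_mul_self hπ
  have hc0 : c ≠ 0 := by
    rintro rfl
    rw [zero_mul] at hcd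
    exact HopfWeakForm.finrank_cast_ne_zero K H hcd.symm
  have h1 := HopfWeakForm.isIntegral_of_isWeakForm hH (pow_ne_zero 2 hc0) hc
  -- By transitivity `c ^ 2`, and hence `c`, is integral over `ℤ`.
  have : Algebra.IsIntegral ℤ ↥((integralClosure ℤ K).toSubring ⊓ L.toSubring) := by
    refine ⟨fun r => ?_⟩
    rw [← isIntegral_algebraMap_iff (B := K) Subtype.val_injective]
    exact r.2.1
  exact HopfWeakForm.dvd_of_isIntegral_of_mul_eq
    (IsIntegral.of_pow two_pos (isIntegral_trans (R := ℤ) _ h1)) hd.out hcd
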